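/- Let $\mathcal N=\{1,\dots,n\}$ be a set of agents and $\mathcal M$ a set of $m$ indivisible items. Each agent $i$ has values $v_i(g)>0$ for the items, extended additively: $v_i(S)=\sum_{g\in S}v_i(g)$ for $S\subseteq\mathcal M$. An allocation of $S\subseteq\mathcal M$ is a tuple $(A_1,\dots,A_n)$ of pairwise disjoint (possibly empty) bundles with union $S$. Its Nash welfare is $\mathrm{NW}(A)=\bigl(\prod_{i=1}^n v_i(A_i)\bigr)^{1/n}$, and $\mathrm{opt}(\mathcal M)$ is the maximum of $\mathrm{NW}$ over all allocations of $\mathcal M$. For a bundle $B$ put $d_i(B)=\max_{g\in B}v_i(B\setminus\{g\})$, with $d_i(\emptyset)=0$. An allocation $A$ (of some $S\subseteq\mathcal M$) is EFX if $v_i(A_i)\ge d_i(A_j)$ for all $i,j$, and it is $\alpha$-efficient if $\alpha\cdot\mathrm{NW}(A)\ge\mathrm{opt}(\mathcal M)$. Algorithm 1 takes as input an allocation $X=(X_1,\dots,X_n)$ of $\mathcal M$ with $\mathrm{NW}(X)=\mathrm{opt}(\mathcal M)$. It starts with $Z=X$ and repeats the following round. Let $G$ be the bipartite graph between the agents and the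 bundles $Z_1,\dots,Z_n$ (distinct vertices, even if equal as sets) in which $(i,Z_j)$ is an edge if and only if $v_i(Z_j)\ge d_i(Z_k)$ for all $k$ and, in case $i\ne j$, $v_i(Z_j)>v_i(Z_i)$. Choose a matching $M$ in $G$ such that (a) every touched bundle, i.e. every $Z_j\neq X_j$, is matched, (b) subject to (a), the number of edges of the form $(i,Z_i)$ in $M$ is maximum, and (c) subject to (a) and (b), $|M|$ is maximum. If $|M|=n$, stop and return $Y=(M(1),\dots,M(n))$, where $M(i)$ is the bundle matched to $i$. Otherwise choose an unmatched agent $i$, a bundle $Z_j$ that maximizes $d_i(Z_j)$ over all $j$, and an item $c\in Z_j$ that minimizes $v_i$ on $Z_j$, and replace $Z_j$ by $Z_j\setminus\{c\}$. Choices and ties are resolved arbitrarily. Theorem. Let $X$ be an allocation of $\mathcal M$ with $\mathrm{NW}(X)=\mathrm{opt}(\mathcal M)$ that satisfies the large market condition with parameter $\varepsilon>0$: $v_i(g)\le\varepsilon\cdot v_i(X_i)$ for every agent $i$ and every item $g\in X_i$. Then Algorithm 1 on input $X$, however its choices are made, is well defined in every round (a matching satisfying (a)–(c) exists, and an item to remove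 exists whenever some agent is unmatched), stops after removing at most $m$ items, and returns an EFX allocation $Y$ of a subset of $\mathcal M$ that is $(1+8\sqrt{\varepsilon})$-efficient. -/

import Mathlib

noncomputable section

namespace EFXDonation

/-- The additive value `v_i(B)` of agent `i` for a bundle `B`. -/
def val {n m : ℕ} (v : Fin n → Fin m → ℝ) (i : Fin n) (B : Finset (Fin m)) : ℝ :=
  ∑ g ∈ B, v i g

/-- `A = (A_1, …, A_n)` is an allocation of the item set `S`: an ordered partition of `S`
into `n` pairwise disjoint (possibly empty) bundles. -/
def IsAllocation {n m : ℕ} (A : Fin n → Finset (Fin m)) (S : Finset (Fin m)) : Prop :=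
  (∀ i j, i ≠ j → Disjoint (A i) (A j)) ∧ Finset.univ.biUnion A = S

/-- `max_{g ∈ B} v_i(B \ {g})`, with value `0` for the empty bundle. -/
def maxDrop {n m : ℕ} (v : Fin n → Fin m → ℝ) (i : Fin n) (B : Finset (Fin m)) : ℝ :=
  if h : B.Nonempty then B.sup' h (fun g => val v i (B.erase g)) else 0

/-- Envy-freeness up to any item. -/
def IsEFX {n m : ℕ} (v : Fin n → Fin m → ℝ) (A : Fin n → Finset (Fin m)) : Prop :=
  ∀ i j, maxDrop v i (A j) ≤ val v i (A i)

/-- Nash welfare: the geometric mean of the agents' values. -/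
def nashWelfare {n m : ℕ} (v : Fin n → Fin m → ℝ) (A : Fin n → Finset (Fin m)) : ℝ :=
  (∏ i, val v i (A i)) ^ ((1 : ℝ) / (n : ℝ))

/-- The maximum Nash welfare over all allocations of `S`. There are finitely many allocations,
so the supremum is a maximum. -/
def opt {n m : ℕ} (v : Fin n → Fin m → ℝ) (S : Finset (Fin m)) : ℝ :=
  sSup {w : ℝ | ∃ A : Fin n → Finset (Fin m), IsAllocation A S ∧ nashWelfare v A = w}

/-- `α`-efficiency, measured against the optimum for the whole item set. -/
def IsEfficient {n m : ℕ} (v : Fin n → Fin m → ℝ) (α : ℝ) (A : Fin n → Finset (Fin m)) : Prop :=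
  opt v Finset.univ ≤ α * nashWelfare v A

/-- The large market condition with parameter `ε` for the allocation `X`. -/
def LargeMarket {n m : ℕ} (v : Fin n → Fin m → ℝ) (X : Fin n → Finset (Fin m)) (ε : ℝ) : Prop :=
  ∀ i, ∀ g ∈ X i, v i g ≤ ε * val v i (X i)

/-! ### The algorithm

`X` is the input allocation and `Z` the current tuple of bundles. The bundle vertex `Z_j` of the
EFX feasibility graph is represented by its index `j`, an edge `(i, Z_j)` by the pair `(i, j)`. -/

/-- Edge `(i, Z_j)` of the EFX feasibility graph of `Z`. -/
def IsEdge {n m : ℕ} (v : Fin n → Fin m → ℝ) (Z : Fin n → Finset (Fin m)) (i j : Fin n) : Prop :=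
  (∀ k, maxDrop v i (Z k) ≤ val v i (Z j)) ∧ (i ≠ j → val v i (Z i) < val v i (Z j))

/-- `M` is a matching in the EFX feasibility graph of `Z`. -/
def IsMatching {n m : ℕ} (v : Fin n → Fin m → ℝ) (Z : Fin n → Finset (Fin m))
    (M : Finset (Fin n × Fin n)) : Prop :=
  (∀ e ∈ M, IsEdge v Z e.1 e.2) ∧
    ∀ e ∈ M, ∀ f ∈ M, (e.1 = f.1 ∨ e.2 = f.2) → e = f

/-- `M` is a matching that covers every touched bundle, i.e. every bundle that misses an item of
the corresponding bundle of `X`. -/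
def CoversTouched {n m : ℕ} (v : Fin n → Fin m → ℝ) (X Z : Fin n → Finset (Fin m))
    (M : Finset (Fin n × Fin n)) : Prop :=
  IsMatching v Z M ∧ ∀ j, Z j ≠ X j → ∃ i, (i, j) ∈ M

/-- The number of edges of the form `(i, Z_i)` in `M`. -/
def ownCount {n : ℕ} (M : Finset (Fin n × Fin n)) : ℕ :=
  (M.filter (fun e => e.1 = e.2)).card

/-- `M` may be chosen in a round with current bundles `Z`: (a) it covers all touched bundles;
(b) under (a) it has the most edges `(i, Z_i)`; (c) under (a) and (b) it has maximum size. -/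
def IsRoundMatching {n m : ℕ} (v : Fin n → Fin m → ℝ) (X Z : Fin n → Finset (Fin m))
    (M : Finset (Fin n × Fin n)) : Prop :=
  CoversTouched v X Z M ∧
    (∀ M', CoversTouched v X Z M' → ownCount M' ≤ ownCount M) ∧
    (∀ M', CoversTouched v X Z M' → ownCount M' = ownCount M → M'.card ≤ M.card)

/-- Agent `i` is not matched in `M`. -/
def Unmatched {n : ℕ} (M : Finset (Fin n × Fin n)) (i : Fin n) : Prop :=
  ∀ j, (i, j) ∉ M

/-- `Z_j` is a robust demand bundle of agent `i`. -/
def IsRobustDemand {n m : ℕ} (v : Fin n → Fin m → ℝ) (Z : Fin n → Finset (Fin m))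
    (i j : Fin n) : Prop :=
  ∀ k, maxDrop v i (Z k) ≤ maxDrop v i (Z j)

/-- `c` is an item of `B` of least value for agent `i`. -/
def IsLeastItem {n m : ℕ} (v : Fin n → Fin m → ℝ) (i : Fin n) (B : Finset (Fin m))
    (c : Fin m) : Prop :=
  c ∈ B ∧ ∀ g ∈ B, v i c ≤ v i g

/-- One round that does not end the algorithm may turn the bundles `Z` into `Z'`: with a chosen
matching `M` and an unmatched agent `i`, an item of least value for `i` is removed from a robust
demand bundle of `i`. All choices and tie-breakings are allowed. -/
def RoundStep {n m : ℕ} (v : Fin n → Fin m → ℝ) (X Z Z' : Fin n → Finset (Fin m)) : Prop :=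
  ∃ M i j c, IsRoundMatching v X Z M ∧ Unmatched M i ∧ IsRobustDemand v Z i j ∧
    IsLeastItem v i (Z j) c ∧ Z' = Function.update Z j ((Z j).erase c)

/-- Some run of the algorithm on input `X` holds the bundles `Z` after `t` item removals. -/
inductive Reaches {n m : ℕ} (v : Fin n → Fin m → ℝ) (X : Fin n → Finset (Fin m)) :
    ℕ → (Fin n → Finset (Fin m)) → Prop
  | start : Reaches v X 0 X
  | round (t : ℕ) (Z Z' : Fin n → Finset (Fin m)) :
      Reaches v X t Z → RoundStep v X Z Z' → Reaches v X (t + 1) Z'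

/-- Some run of the algorithm on input `X` returns `Y = (M(1), …, M(n))`, where `M` is the
matching of the last round, `|M| = n`. -/
def Returns {n m : ℕ} (v : Fin n → Fin m → ℝ) (X Y : Fin n → Finset (Fin m)) : Prop :=
  ∃ t Z M, Reaches v X t Z ∧ IsRoundMatching v X Z M ∧ M.card = n ∧
    ∀ i, ∃ j, (i, j) ∈ M ∧ Y i = Z j

/-- The algorithm is well defined on input `X`, whatever choices are made: in every round that
is reached, a matching as required exists, and whenever an agent is left unmatched, her robust
demand bundles contain an item to remove. -/
def NeverStuck {n m : ℕ} (v : Fin n → Fin m → ℝ) (X : Fin n → Finset (Fin m)) : Prop :=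
  ∀ t Z, Reaches v X t Z →
    (∃ M, IsRoundMatching v X Z M) ∧
    ∀ M i, IsRoundMatching v X Z M → Unmatched M i →
      ∀ j, IsRobustDemand v Z i j → ∃ c, IsLeastItem v i (Z j) c

end EFXDonation

end

open EFXDonation

/-!
Let `p i` be the value of the current bundle `Z i` for agent `i`, in units of the value of `X i`.

**Matchings.** If agent `i` is unmatched in a round, the edge `(i, i)` is absent, since otherwise it
could replace the edge at `Z i` and increase the number of such edges. Hence `i` values `Z i` less
than her robust demand bundle `Z j` with its least item removed. So `j ≠ i`, an item to remove
exists, and after the removal `i` can be matched to `Z j`; all other edges of the matching survive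
(`RoundStep.exists_coversTouched`). Thus a matching that covers the touched bundles always exists,
and since every round removes an item, a run ends, with everybody matched to a bundle that makes
the result EFX.

**Efficiency.** The returned bundle of `i` is worth at least `Z i` to her, so it suffices that
`p j` stays at least `1 / (1 + 8 * √ε)`. Only the bundle `Z j` of the last removal has to be
considered. It is now matched to an agent other than `j`, and passing repeatedly from an agent to
the one who is matched to her bundle gives a path `j = a 0, …, a k` that ends with an untouched
bundle, along which everybody prefers the predecessor's bundle to her own (`exists_isEnvyPath`);
a cycle would allow an improvement of `X`. Each agent of the path may pass a part of her bundle on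
to the next, and the optimality of `X` bounds the product of the relative values that result
(`IsPosOptimal.prod_path_le`).

* If all but the last agent pass on their whole bundles, only `j` loses, and the last agent doubles
  her value. This gives `p j ≥ 1 / 2`, which settles the case `√ε ≥ 1 / 8`.
* If `√ε < 1 / 8`, optimality under the transfer of a single item shows that agents value parts of
  other bundles at most `1 / (1 - ε)` times as much as their owners (`relVal_le_of_ne`). Hence, if
  an agent keeps the relative value `t l` and her predecessor keeps `t (l - 1)`, her gain is at least
  `t l - t (l - 1) / (1 - ε)`. Moreover `p` grows by at most the factor `1 / (1 - ε)` per step, so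
  `p j < 1 - 4 * √ε` forces the path to have more than `4 / √ε` steps. That is long enough to let
  `t` decrease slowly from `p j` to `0` at the start of the path and increase slowly from `0` to `1`
  at its end (`rampTarget`). The gains sum to about `1 - p j`, the sum of their squares is
  of order `√ε`, and the product of the relative values exceeds `1` (`one_lt_prod_ramp`), a
  contradiction.
-/

namespace EFXDonation

/-! ### Valuations and matchings -/

section

variable {n m : ℕ} {v : Fin n → Fin m → ℝ}

theorem val_nonneg (hv : ∀ i g, 0 < v i g) (i : Fin n) (B : Finset (Fin m)) : 0 ≤ val v i B :=
  Finset.sum_nonneg fun g _ => (hv i g).le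

theorem val_mono (hv : ∀ i g, 0 < v i g) (i : Fin n) {B C : Finset (Fin m)} (h : B ⊆ C) :
    val v i B ≤ val v i C :=
  Finset.sum_le_sum_of_subset_of_nonneg h fun g _ _ => (hv i g).le

theorem val_sdiff (i : Fin n) {B C : Finset (Fin m)} (h : B ⊆ C) :
    val v i (C \ B) = val v i C - val v i B := by
  have := Finset.sum_sdiff (f := v i) h
  simp only [val]
  linarith

theorem val_union (i : Fin n) {B C : Finset (Fin m)} (h : Disjoint B C) :
    val v i (B ∪ C) = val v i B + val v i C :=
  Finset.sum_union h

theorem maxDrop_le_val (hv : ∀ i g, 0 < v i g) (i : Fin n) (B : Finset (Fin m)) :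
    maxDrop v i B ≤ val v i B := by
  unfold maxDrop
  split_ifs with h
  · exact Finset.sup'_le _ _ fun g _ => val_mono hv i (Finset.erase_subset _ _)
  · exact val_nonneg hv i B

theorem maxDrop_erase_le (hv : ∀ i g, 0 < v i g) (i : Fin n) (B : Finset (Fin m)) (c : Fin m) :
    maxDrop v i (B.erase c) ≤ maxDrop v i B := by
  by_cases h : (B.erase c).Nonempty
  · have hB : B.Nonempty := h.mono (Finset.erase_subset _ _)
    simp only [maxDrop, h, hB, dif_pos]
    refine Finset.sup'_le _ _ fun g hg => ?_
    exact (val_mono hv i (Finset.erase_subset_erase _ (Finset.erase_subset _ _))).trans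
      (Finset.le_sup' (fun g => val v i (B.erase g)) (Finset.mem_of_mem_erase hg))
  · by_cases hB : B.Nonempty
    · simp only [maxDrop, h, hB, dif_pos, dif_neg, not_false_eq_true]
      obtain ⟨g, hg⟩ := hB
      exact (val_nonneg hv i _).trans (Finset.le_sup' (fun g => val v i (B.erase g)) hg)
    · simp [maxDrop, h, hB]

/-- Dropping an item of least value attains the maximum in `maxDrop`. -/
theorem maxDrop_eq_val_erase {i : Fin n} {B : Finset (Fin m)} {c : Fin m}
    (hc : IsLeastItem v i B c) : maxDrop v i B = val v i (B.erase c) := by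
  have hB : B.Nonempty := ⟨c, hc.1⟩
  simp only [maxDrop, hB, dif_pos]
  refine le_antisymm (Finset.sup'_le _ _ fun g hg => ?_)
    (Finset.le_sup' (fun g => val v i (B.erase g)) hc.1)
  have h1 := Finset.add_sum_erase B (v i) hg
  have h2 := Finset.add_sum_erase B (v i) hc.1
  have h3 := hc.2 g hg
  simp only [val]
  linarith

theorem exists_isLeastItem (i : Fin n) {B : Finset (Fin m)} (hB : B.Nonempty) :
    ∃ c, IsLeastItem v i B c :=
  B.exists_min_image (v i) hB

theorem exists_isRobustDemand (Z : Fin n → Finset (Fin m)) (i : Fin n) :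
    ∃ j, IsRobustDemand v Z i j := by
  obtain ⟨j, -, hj⟩ := Finset.univ.exists_max_image (fun j => maxDrop v i (Z j)) ⟨i, by simp⟩
  exact ⟨j, fun k => hj k (by simp)⟩

variable {X Z : Fin n → Finset (Fin m)}

theorem exists_isRoundMatching (h : ∃ M, CoversTouched v X Z M) :
    ∃ M, IsRoundMatching v X Z M := by
  classical
  obtain ⟨M₀, h₀⟩ := h
  obtain ⟨M₁, h₁, hmax₁⟩ := (Finset.univ.filter (CoversTouched v X Z)).exists_max_image ownCount
    ⟨M₀, by simpa using h₀⟩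
  obtain ⟨M₂, h₂, hmax₂⟩ :=
    (Finset.univ.filter fun M => CoversTouched v X Z M ∧ ownCount M = ownCount M₁).exists_max_image
      Finset.card ⟨M₁, by simpa using h₁⟩
  simp only [Finset.mem_filter, Finset.mem_univ, true_and] at *
  exact ⟨M₂, h₂.1, fun M' h' => h₂.2 ▸ hmax₁ M' h', fun M' h' he => hmax₂ M' ⟨h', he.trans h₂.2⟩⟩

/-- Matching `(i, j)` instead of whatever was matched to the bundle `j`. -/
def rematch (M : Finset (Fin n × Fin n)) (i j : Fin n) : Finset (Fin n × Fin n) :=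
  insert (i, j) (M.filter fun e => e.2 ≠ j)

theorem mem_rematch {M : Finset (Fin n × Fin n)} {i j : Fin n} {e : Fin n × Fin n} :
    e ∈ rematch M i j ↔ e = (i, j) ∨ e ∈ M ∧ e.2 ≠ j := by
  simp [rematch]

/-- An unmatched agent can take over any bundle. The edges other than `(i, j)` may come from
another graph `Z'`, as long as they survive in it. -/
theorem CoversTouched.rematch {Z' : Fin n → Finset (Fin m)} {M : Finset (Fin n × Fin n)}
    {i j : Fin n} (hM : CoversTouched v X Z M) (hi : Unmatched M i) (hij : IsEdge v Z' i j)
    (hedge : ∀ k l, l ≠ j → IsEdge v Z k l → IsEdge v Z' k l) (hZ : ∀ l, l ≠ j → Z' l = Z l) :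
    CoversTouched v X Z' (rematch M i j) := by
  refine ⟨⟨fun e he => ?_, fun e he f hf hef => ?_⟩, fun l hl => ?_⟩
  · rcases mem_rematch.1 he with rfl | ⟨he, hj⟩
    · exact hij
    · exact hedge _ _ hj (hM.1.1 e he)
  · rcases mem_rematch.1 he with rfl | ⟨he, hej⟩ <;> rcases mem_rematch.1 hf with rfl | ⟨hf, hfj⟩
    · rfl
    · rcases hef with h | h
      · exact absurd (show (i, f.2) ∈ M by rw [show i = f.1 from h]; exact hf) (hi _)
      · exact absurd h.symm hfj
    · rcases hef with h | h
      · exact absurd (show (i, e.2) ∈ M by rw [show i = e.1 from h.symm]; exact he) (hi _)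
      · exact absurd h hej
    · exact hM.1.2 e he f hf hef
  · by_cases hlj : l = j
    · exact ⟨i, mem_rematch.2 (Or.inl (by rw [hlj]))⟩
    · obtain ⟨k, hk⟩ := hM.2 l (by rwa [← hZ l hlj])
      exact ⟨k, mem_rematch.2 (Or.inr ⟨hk, hlj⟩)⟩

/-- By the maximality of the number of edges `(i, Z_i)`, an unmatched agent is never adjacent to
her own bundle. -/
theorem not_isEdge_self_of_unmatched {M : Finset (Fin n × Fin n)} {i : Fin n}
    (hM : IsRoundMatching v X Z M) (hi : Unmatched M i) : ¬ IsEdge v Z i i := by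
  intro h
  have hle := hM.2.1 _ (hM.1.rematch hi h (fun _ _ _ h => h) fun _ _ => rfl)
  have hlt : ownCount M < ownCount (rematch M i i) := by
    refine Finset.card_lt_card (Finset.ssubset_iff_of_subset ?_ |>.2 ⟨(i, i), ?_, ?_⟩)
    · intro e he
      rw [Finset.mem_filter] at he ⊢
      refine ⟨mem_rematch.2 (Or.inr ⟨he.1, fun h2 => hi e.2 ?_⟩), he.2⟩
      have : (i, e.2) = e := Prod.ext (by rw [he.2, h2]) rfl
      rw [this]; exact he.1
    · simp [mem_rematch]
    · simp [hi i]
  omega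

theorem val_lt_maxDrop_of_unmatched {M : Finset (Fin n × Fin n)} {i j : Fin n}
    (hM : IsRoundMatching v X Z M) (hi : Unmatched M i) (hj : IsRobustDemand v Z i j) :
    val v i (Z i) < maxDrop v i (Z j) := by
  by_contra! h
  exact not_isEdge_self_of_unmatched hM hi ⟨fun k => (hj k).trans h, fun h => absurd rfl h⟩

theorem nonempty_of_unmatched (hv : ∀ i g, 0 < v i g) {M : Finset (Fin n × Fin n)} {i j : Fin n}
    (hM : IsRoundMatching v X Z M) (hi : Unmatched M i) (hj : IsRobustDemand v Z i j) :
    (Z j).Nonempty := by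
  by_contra h
  have h1 := val_lt_maxDrop_of_unmatched hM hi hj
  rw [maxDrop, dif_neg h] at h1
  exact absurd (val_nonneg hv i (Z i)) (not_le.2 h1)

/-- A round preserves the existence of a matching that covers all touched bundles: the agent whose
robust demand bundle loses an item is matched to what is left of it. -/
theorem RoundStep.exists_coversTouched (hv : ∀ i g, 0 < v i g) {Z' : Fin n → Finset (Fin m)}
    (h : RoundStep v X Z Z') :
    ∃ M i j, ∃ c ∈ Z j, i ≠ j ∧ Z' = Function.update Z j ((Z j).erase c) ∧
      CoversTouched v X Z' M ∧ (i, j) ∈ M := by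
  obtain ⟨M, i, j, c, hM, hi, hj, hc, rfl⟩ := h
  have hlt := val_lt_maxDrop_of_unmatched hM hi hj
  have hij : i ≠ j := by
    rintro rfl
    exact absurd (maxDrop_le_val hv i (Z i)) (not_le.2 hlt)
  have hdrop : ∀ k l, maxDrop v k (Function.update Z j ((Z j).erase c) l) ≤ maxDrop v k (Z l) := by
    intro k l
    by_cases hl : l = j
    · subst hl; simpa using maxDrop_erase_le hv k (Z l) c
    · simp [hl]
  refine ⟨EFXDonation.rematch M i j, i, j, c, hc.1, hij, rfl,
    hM.1.rematch hi ⟨fun k => ?_, fun _ => ?_⟩ (fun k l hl hkl => ⟨fun r => ?_, fun hne => ?_⟩)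
    (fun l hl => by simp [hl]),
    mem_rematch.2 (Or.inl rfl)⟩
  · rw [Function.update_self, ← maxDrop_eq_val_erase hc]
    exact (hdrop i k).trans (hj k)
  · rw [Function.update_self, ← maxDrop_eq_val_erase hc, Function.update_of_ne hij]
    exact hlt
  · rw [Function.update_of_ne hl]
    exact (hdrop k r).trans (hkl.1 r)
  · rw [Function.update_of_ne hl]
    refine lt_of_le_of_lt ?_ (hkl.2 hne)
    by_cases hk : k = j
    · subst hk; simpa using val_mono hv k (Finset.erase_subset c (Z k))
    · simp [hk]

/-- The invariants of a run: the bundles only shrink, each removal costs one item, and there is a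
matching that covers all touched bundles. -/
theorem Reaches.invariant (hv : ∀ i g, 0 < v i g) {t : ℕ} (h : Reaches v X t Z) :
    (∀ j, Z j ⊆ X j) ∧ t + ∑ j, (Z j).card = ∑ j, (X j).card ∧ ∃ M, CoversTouched v X Z M := by
  induction h with
  | start => exact ⟨fun _ => subset_rfl, by simp, ∅, ⟨by simp, by simp⟩, fun j hj => absurd rfl hj⟩
  | round t Z Z' _ hstep ih =>
    obtain ⟨M, i, j, c, hc, -, rfl, hM, -⟩ := hstep.exists_coversTouched hv
    refine ⟨fun l => ?_, ?_, M, hM⟩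
    · by_cases hl : l = j
      · subst hl; simpa using (Finset.erase_subset c _).trans (ih.1 l)
      · simpa [hl] using ih.1 l
    · rw [← ih.2.1, ← Finset.add_sum_erase _ _ (Finset.mem_univ j),
        ← Finset.add_sum_erase Finset.univ (fun l => (Z l).card) (Finset.mem_univ j),
        Function.update_self, Finset.card_erase_of_mem hc,
        Finset.sum_congr rfl fun l hl => by rw [Function.update_of_ne (Finset.ne_of_mem_erase hl)]]
      have := Finset.card_pos.2 ⟨c, hc⟩
      omega

theorem IsAllocation.sum_card (hX : IsAllocation X Finset.univ) : ∑ j, (X j).card = m := by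
  rw [← Finset.card_biUnion fun i _ j _ hij => hX.1 i j hij, hX.2]
  simp

/-- A matching with `n` edges is a permutation. -/
theorem exists_perm_of_card_eq {M : Finset (Fin n × Fin n)} (hM : IsMatching v Z M)
    (hcard : M.card = n) : ∃ σ : Equiv.Perm (Fin n), ∀ i j, (i, j) ∈ M ↔ σ i = j := by
  have h1 : M.image Prod.fst = Finset.univ := by
    apply Finset.eq_univ_of_card
    rw [Finset.card_image_of_injOn fun e he f hf h => hM.2 e he f hf (Or.inl h)]
    simpa using hcard
  have h2 : ∀ i, ∃ j, (i, j) ∈ M := fun i => by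
    have : i ∈ M.image Prod.fst := by rw [h1]; simp
    obtain ⟨e, he, rfl⟩ := Finset.mem_image.1 this
    exact ⟨e.2, he⟩
  choose f hf using h2
  have hinj : Function.Injective f := fun a b hab =>
    congrArg Prod.fst (hM.2 _ (hf a) _ (hf b) (Or.inr hab))
  refine ⟨Equiv.ofBijective f (Finite.injective_iff_bijective.1 hinj), fun i j => ⟨fun h => ?_, ?_⟩⟩
  · exact congrArg Prod.snd (hM.2 _ (hf i) _ h (Or.inl rfl))
  · rintro rfl
    exact hf i

/-- A matching with no unmatched agent has `n` edges. -/
theorem IsMatching.card_eq {M : Finset (Fin n × Fin n)} (hM : IsMatching v Z M)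
    (h : ∀ i, ¬ Unmatched M i) : M.card = n := by
  rw [← Finset.card_image_of_injOn (f := Prod.fst)
    fun e he f hf h => hM.2 e he f hf (Or.inl h)]
  have : M.image Prod.fst = Finset.univ := by
    refine Finset.eq_univ_iff_forall.2 fun i => ?_
    have := h i
    simp only [Unmatched, not_forall, not_not] at this
    obtain ⟨j, hj⟩ := this
    exact Finset.mem_image.2 ⟨_, hj, rfl⟩
  rw [this]
  simp

/-- Some run returns an allocation: a run of maximal length ends with all agents matched. -/
theorem exists_returns (hv : ∀ i g, 0 < v i g) : ∃ Y, Returns v X Y := by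
  classical
  have hbdd : ∀ t, (∃ Z, Reaches v X t Z) → t ≤ ∑ j, (X j).card := by
    rintro t ⟨Z, hZ⟩
    have := (hZ.invariant hv).2.1
    omega
  let T := Nat.findGreatest (fun t => ∃ Z, Reaches v X t Z) (∑ j, (X j).card)
  obtain ⟨Z, hZ⟩ : ∃ Z, Reaches v X T Z :=
    Nat.findGreatest_spec (P := fun t => ∃ Z, Reaches v X t Z) (Nat.zero_le _) ⟨X, .start⟩
  obtain ⟨M, hM⟩ := exists_isRoundMatching (hZ.invariant hv).2.2
  have hcard : M.card = n := by
    refine hM.1.1.card_eq fun i hi => ?_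
    obtain ⟨j, hj⟩ := exists_isRobustDemand (v := v) Z i
    obtain ⟨c, hc⟩ := exists_isLeastItem (v := v) i (nonempty_of_unmatched hv hM hi hj)
    have hr := Reaches.round T Z _ hZ ⟨M, i, j, c, hM, hi, hj, hc, rfl⟩
    have := Nat.le_findGreatest (P := fun t => ∃ Z, Reaches v X t Z) (hbdd _ ⟨_, hr⟩) ⟨_, hr⟩
    exact absurd this (Nat.not_succ_le_self _)
  obtain ⟨σ, hσ⟩ := exists_perm_of_card_eq hM.1.1 hcard
  exact ⟨fun i => Z (σ i), T, Z, M, hZ, hM, hcard, fun i => ⟨σ i, (hσ _ _).2 rfl, rfl⟩⟩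

end

/-! ### Passing goods along a long path -/

theorem sub_sq_le_log_one_add {x : ℝ} (hx : |x| ≤ 1 / 5) :
    x - 3 / 4 * x ^ 2 ≤ Real.log (1 + x) := by
  have h := Real.abs_log_sub_add_sum_range_le (x := -x) (by rw [abs_neg]; linarith) 2
  simp only [abs_neg, Finset.sum_range_succ, Finset.sum_range_zero, sub_neg_eq_add] at h
  norm_num at h
  have h2 : |x| ^ 3 / (1 - |x|) ≤ x ^ 2 / 4 := by
    rw [div_le_iff₀ (by linarith), ← sq_abs x]
    nlinarith [mul_nonneg (sq_nonneg |x|) (sub_nonneg.2 hx)]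
  have := (abs_le.1 (h.trans h2)).1
  linarith

/-- The share of her bundle that the agent at position `l` of a path of length `N + q + N` aims to
keep: it falls linearly from `p` to `0` in the first `N` positions, stays `0`, and rises linearly
to `1` in the last `N`. -/
noncomputable def rampTarget (p : ℝ) (N q l : ℕ) : ℝ :=
  if l < N then p * (1 - (l + 1) / N) else if l < N + q then 0 else ((l : ℝ) - N - q) / N

section

variable {p : ℝ} {N q : ℕ}

theorem rampTarget_of_lt {l : ℕ} (h : l < N) : rampTarget p N q l = p * (1 - (l + 1) / N) := by
  simp [rampTarget, h]

theorem rampTarget_add (l : ℕ) : rampTarget p N q (N + q + l) = (l : ℝ) / N := by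
  have h1 : ¬ (N + q + l < N) := by omega
  simp [rampTarget, h1]
  ring

theorem rampTarget_eq_zero {l : ℕ} (h1 : N ≤ l + 1) (h2 : l ≤ N + q) (hN : 0 < N) :
    rampTarget p N q l = 0 := by
  unfold rampTarget
  split_ifs with h h'
  · have : (l : ℝ) + 1 = N := by exact_mod_cast (by omega : l + 1 = N)
    rw [this, div_self (by positivity)]; ring
  · rfl
  · have : l = N + q := by omega
    subst this; push_cast; ring_nf

theorem rampTarget_nonneg (hp : 0 ≤ p) (hN : 0 < N) (l : ℕ) : 0 ≤ rampTarget p N q l := by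
  have hN' : (0 : ℝ) < N := by exact_mod_cast hN
  unfold rampTarget
  split_ifs with h h'
  · have : (l : ℝ) + 1 ≤ N := by exact_mod_cast h
    exact mul_nonneg hp (by rw [sub_nonneg, div_le_one hN']; exact this)
  · rfl
  · have : (N : ℝ) + q ≤ l := by exact_mod_cast (not_lt.1 h')
    exact div_nonneg (by linarith) hN'.le

theorem rampTarget_le_one (hp : 0 ≤ p) (hp1 : p ≤ 1) (hN : 0 < N) {l : ℕ} (hl : l ≤ N + q + N) :
    rampTarget p N q l ≤ 1 := by
  have hN' : (0 : ℝ) < N := by exact_mod_cast hN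
  unfold rampTarget
  split_ifs with h h'
  · have : 0 ≤ ((l : ℝ) + 1) / N := by positivity
    nlinarith
  · exact zero_le_one
  · have : (l : ℝ) ≤ N + q + N := by exact_mod_cast hl
    rw [div_le_one hN']; linarith

theorem abs_rampTarget_succ_sub (hp : 0 ≤ p) (hp1 : p ≤ 1) (hN : 0 < N) (l : ℕ) :
    |rampTarget p N q (l + 1) - rampTarget p N q l| ≤ 1 / N := by
  have hN' : (0 : ℝ) < N := by exact_mod_cast hN
  rcases lt_or_ge (l + 1) N with h | h
  · rw [rampTarget_of_lt h, rampTarget_of_lt (by omega)]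
    have : p * (1 - ((l + 1 : ℕ) + 1 : ℝ) / N) - p * (1 - ((l : ℝ) + 1) / N) = -(p * (1 / N)) := by
      push_cast; ring
    rw [this, abs_neg, abs_of_nonneg (by positivity)]
    exact mul_le_of_le_one_left (by positivity) hp1
  · rcases lt_or_ge l (N + q) with h' | h'
    · rw [rampTarget_eq_zero (by omega) (by omega) hN, rampTarget_eq_zero (by omega) (by omega) hN]
      simp
    · obtain ⟨r, rfl⟩ := Nat.exists_eq_add_of_le h'
      rw [add_assoc (N + q), rampTarget_add, rampTarget_add, ← sub_div]
      push_cast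
      rw [add_sub_cancel_left, abs_of_nonneg (by positivity)]

theorem sum_rampTarget_le (hp : p ≤ 1) (hN : 0 < N) :
    ∑ l ∈ Finset.range (N + q + N), rampTarget p N q l ≤ N - 1 := by
  have hN' : (0 : ℝ) < N := by exact_mod_cast hN
  rw [Finset.sum_range_add, Finset.sum_range_add,
    Finset.sum_eq_zero (s := Finset.range q) fun l hl =>
      rampTarget_eq_zero (by omega) (by have := Finset.mem_range.1 hl; omega) hN,
    add_zero, ← Finset.sum_add_distrib]
  calc ∑ l ∈ Finset.range N, (rampTarget p N q l + rampTarget p N q (N + q + l))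
      ≤ ∑ l ∈ Finset.range N, (1 - 1 / (N : ℝ)) := by
        refine Finset.sum_le_sum fun l hl => ?_
        have hl' : (l : ℝ) + 1 ≤ N := by exact_mod_cast Finset.mem_range.1 hl
        rw [rampTarget_of_lt (Finset.mem_range.1 hl), rampTarget_add]
        have h1 : ((l : ℝ) + 1) / N ≤ 1 := (div_le_one hN').2 hl'
        have h2 : ((l : ℝ) + 1) / N = l / N + 1 / N := add_div _ _ _
        nlinarith
    _ = N - 1 := by
        rw [Finset.sum_const, Finset.card_range, nsmul_eq_mul]
        field_simp

end

/-- If the kept values `t l` follow `rampTarget` up to an error `ε = s ^ 2`, and `p < 1 - 4 * s`,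
then the relative gains along the path multiply to more than `1` (the first
conjunct is the positivity of the factors). With the relative gains written
as `1 + y l`, the `y l` sum to `1 - p` up to the `ε`-terms of the denominators `1 - ε`, and only
the `2 * N ≈ 2 / s` positions on the two slopes contribute squares, each of size about `s ^ 2`. -/
theorem one_lt_prod_ramp {s ε p : ℝ} {N q : ℕ} {t : ℕ → ℝ} (hs : 0 < s) (hs8 : s < 1 / 8)
    (hε : ε = s ^ 2) (hp : 0 ≤ p) (hps : p < 1 - 4 * s) (hN1 : 1 / s ≤ N) (hN2 : N < 1 / s + 1)
    (ht0 : ∀ l ≤ N + q + N, 0 ≤ t l) (htle : ∀ l ≤ N + q + N, t l ≤ rampTarget p N q l)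
    (htge : ∀ l ≤ N + q + N, rampTarget p N q l - ε ≤ t l) (htk : t (N + q + N) = 1) :
    (∀ l < N + q + N, 0 < 1 + t (l + 1) - t l / (1 - ε)) ∧
      1 < (1 - p + t 0) * ∏ l ∈ Finset.range (N + q + N), (1 + t (l + 1) - t l / (1 - ε)) := by
  have hN' : (0 : ℝ) < N := lt_of_lt_of_le (by positivity) hN1
  have hN : 0 < N := by exact_mod_cast hN'
  have hp1 : p ≤ 1 := by linarith
  have hε0 : 0 < ε := by rw [hε]; positivity
  have hε8 : ε ≤ s / 8 := by rw [hε]; nlinarith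
  have h1ε : 0 < 1 - ε := by linarith
  set η := ε / (1 - ε) with hη
  have hη0 : 0 ≤ η := by positivity
  have hηε : η ≤ 64 / 63 * s ^ 2 := by
    rw [hη, div_le_iff₀ h1ε, hε]
    have : s ^ 2 ≤ 1 / 64 := by nlinarith
    nlinarith [sq_nonneg s]
  have hNinv : 1 / (N : ℝ) ≤ s := by
    rw [div_le_iff₀ hN']
    rw [div_le_iff₀ hs] at hN1
    linarith
  let y : ℕ → ℝ := fun l => Nat.casesOn l (t 0 - p) fun l => t (l + 1) - t l - η * t l
  set D := s + ε + η with hD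
  have hDs : D ≤ 79 / 63 * s := by
    have : s ^ 2 ≤ s / 8 := by nlinarith
    rw [hD, hε]; linarith
  have hD0 : 0 ≤ D := by positivity
  have hyD : ∀ l ≤ N + q + N, |y l| ≤ D := by
    intro l hl
    cases l with
    | zero =>
      have h1 := htle 0 (by omega)
      have h2 := htge 0 (by omega)
      rw [rampTarget_of_lt hN] at h1 h2
      have h3 : p * (1 - ((0 : ℕ) + 1 : ℝ) / N) = p - p * (1 / N) := by push_cast; ring
      have h4 : p * (1 / (N : ℝ)) ≤ 1 / N := mul_le_of_le_one_left (by positivity) hp1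
      have h5 : 0 ≤ p * (1 / (N : ℝ)) := by positivity
      rw [h3] at h1 h2
      change |t 0 - p| ≤ D
      rw [abs_le]; constructor <;> linarith
    | succ l =>
      have h1 := htle l (by omega)
      have h2 := htge l (by omega)
      have h3 := htle (l + 1) hl
      have h4 := htge (l + 1) hl
      have h5 := abs_le.1 (abs_rampTarget_succ_sub (q := q) hp hp1 hN l)
      have h6 := h1.trans (rampTarget_le_one hp hp1 hN (by omega : l ≤ N + q + N))
      have h7 := ht0 l (by omega)
      have h8 : η * t l ≤ η := mul_le_of_le_one_right hη0 h6
      have h9 : 0 ≤ η * t l := by positivity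
      change |t (l + 1) - t l - η * t l| ≤ D
      rw [abs_le]; constructor <;> linarith
  have hzero : ∀ l, N ≤ l + 1 → l ≤ N + q → t l = 0 := fun l h1 h2 =>
    le_antisymm ((htle l (by omega)).trans_eq (rampTarget_eq_zero h1 h2 hN)) (ht0 l (by omega))
  have hsq : ∑ l ∈ Finset.range (N + q + N + 1), y l ^ 2 ≤ 2 * N * D ^ 2 := by
    have hle : ∀ l ≤ N + q + N, y l ^ 2 ≤ D ^ 2 := fun l hl =>
      sq_le_sq' (by have := abs_le.1 (hyD l hl); linarith) (abs_le.1 (hyD l hl)).2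
    rw [show N + q + N + 1 = N + (q + 1) + N by ring, Finset.sum_range_add, Finset.sum_range_add,
      Finset.sum_eq_zero (s := Finset.range (q + 1))]
    · have h1 := Finset.sum_le_card_nsmul (Finset.range N) (fun l => y l ^ 2) (D ^ 2)
        fun l hl => hle l (by have := Finset.mem_range.1 hl; omega)
      have h2 := Finset.sum_le_card_nsmul (Finset.range N)
        (fun l => y (N + (q + 1) + l) ^ 2) (D ^ 2)
        fun l hl => hle _ (by have := Finset.mem_range.1 hl; omega)
      simp only [Finset.card_range, nsmul_eq_mul] at h1 h2
      linarith
    · intro l hl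
      have hl' := Finset.mem_range.1 hl
      obtain ⟨r, hr⟩ : ∃ r, N + l = r + 1 := ⟨N + l - 1, by omega⟩
      rw [hr]
      change (t (r + 1) - t r - η * t r) ^ 2 = 0
      rw [hzero r (by omega) (by omega), hzero (r + 1) (by omega) (by omega)]
      ring
  have hsum : 1 - p - η / s ≤ ∑ l ∈ Finset.range (N + q + N + 1), y l := by
    rw [Finset.sum_range_succ']
    change _ ≤ ∑ l ∈ Finset.range (N + q + N), (t (l + 1) - t l - η * t l) + (t 0 - p)
    rw [Finset.sum_sub_distrib, Finset.sum_range_sub, ← Finset.mul_sum, htk]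
    have h1 : ∑ l ∈ Finset.range (N + q + N), t l ≤ 1 / s :=
      ((Finset.sum_le_sum fun l hl => htle l (Finset.mem_range.1 hl).le).trans
        (sum_rampTarget_le hp1 hN)).trans (by linarith)
    have h2 := mul_le_mul_of_nonneg_left h1 hη0
    rw [mul_one_div] at h2
    linarith
  have hfactor : ∀ l, 1 + t (l + 1) - t l / (1 - ε) = 1 + y (l + 1) := fun l => by
    change _ = 1 + (t (l + 1) - t l - η * t l)
    rw [hη]; field_simp; ring
  have hprod : (1 - p + t 0) * ∏ l ∈ Finset.range (N + q + N), (1 + t (l + 1) - t l / (1 - ε))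
      = ∏ l ∈ Finset.range (N + q + N + 1), (1 + y l) := by
    rw [Finset.prod_range_succ', mul_comm]
    congr 1
    · exact Finset.prod_congr rfl fun l _ => hfactor l
    · change _ = 1 + (t 0 - p); ring
  have hypos : ∀ l ≤ N + q + N, 0 < 1 + y l := fun l hl => by
    have := (abs_le.1 (hyD l hl)).1
    linarith
  refine ⟨fun l hl => hfactor l ▸ hypos (l + 1) hl, ?_⟩
  rw [hprod, ← Real.log_pos_iff (Finset.prod_nonneg fun l hl =>
    (hypos l (Nat.lt_succ_iff.1 (Finset.mem_range.1 hl))).le), Real.log_prod fun l hl =>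
    (hypos l (Nat.lt_succ_iff.1 (Finset.mem_range.1 hl))).ne']
  have hlog : ∑ l ∈ Finset.range (N + q + N + 1), (y l - 3 / 4 * y l ^ 2) ≤
      ∑ l ∈ Finset.range (N + q + N + 1), Real.log (1 + y l) :=
    Finset.sum_le_sum fun l hl => sub_sq_le_log_one_add
      ((hyD l (Nat.lt_succ_iff.1 (Finset.mem_range.1 hl))).trans (by linarith))
  refine lt_of_lt_of_le ?_ hlog
  rw [Finset.sum_sub_distrib, ← Finset.mul_sum]
  have hηs : η / s ≤ 64 / 63 * s := by
    rw [div_le_iff₀ hs]; linarith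
  have hND : N * D ^ 2 ≤ (9 / 8) * (79 / 63) ^ 2 * s := by
    have h1 : D ^ 2 ≤ (79 / 63 * s) ^ 2 := pow_le_pow_left₀ hD0 hDs 2
    have h2 : N * s ≤ 9 / 8 := by
      have : N * s < (1 / s + 1) * s := mul_lt_mul_of_pos_right hN2 hs
      have h3 : (1 / s + 1) * s = 1 + s := by field_simp
      linarith
    calc (N : ℝ) * D ^ 2 ≤ N * (79 / 63 * s) ^ 2 := by gcongr
      _ = (N * s) * ((79 / 63) ^ 2 * s) := by ring
      _ ≤ 9 / 8 * ((79 / 63) ^ 2 * s) := by gcongr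
      _ = _ := by ring
  nlinarith

/-! ### Exchanges along a path of agents -/

section

variable {n m : ℕ} {v : Fin n → Fin m → ℝ} {X : Fin n → Finset (Fin m)}

/-- `X` maximizes the product of the agents' values, and this maximum is positive. -/
structure IsPosOptimal (v : Fin n → Fin m → ℝ) (X : Fin n → Finset (Fin m)) : Prop where
  alloc : IsAllocation X Finset.univ
  pos : ∀ i, 0 < val v i (X i)
  le : ∀ A, IsAllocation A Finset.univ → ∏ i, val v i (A i) ≤ ∏ i, val v i (X i)

/-- The value of `B` for agent `i`, in units of the value of her bundle `X i`. -/
noncomputable def relVal (v : Fin n → Fin m → ℝ) (X : Fin n → Finset (Fin m)) (i : Fin n)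
    (B : Finset (Fin m)) : ℝ :=
  val v i B / val v i (X i)

theorem relVal_self (hX : IsPosOptimal v X) (i : Fin n) : relVal v X i (X i) = 1 :=
  div_self (hX.pos i).ne'

theorem relVal_nonneg (hv : ∀ i g, 0 < v i g) (hX : IsPosOptimal v X) (i : Fin n)
    (B : Finset (Fin m)) : 0 ≤ relVal v X i B :=
  div_nonneg (val_nonneg hv i B) (hX.pos i).le

theorem relVal_le_one (hv : ∀ i g, 0 < v i g) (hX : IsPosOptimal v X) {i : Fin n}
    {B : Finset (Fin m)} (hB : B ⊆ X i) : relVal v X i B ≤ 1 :=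
  (div_le_one (hX.pos i)).2 (val_mono hv i hB)

theorem relVal_empty (i : Fin n) : relVal v X i ∅ = 0 := by simp [relVal, val]

theorem relVal_sdiff (i : Fin n) {B C : Finset (Fin m)} (h : B ⊆ C) :
    relVal v X i (C \ B) = relVal v X i C - relVal v X i B := by
  rw [relVal, val_sdiff i h, sub_div, relVal, relVal]

theorem relVal_lt (hX : IsPosOptimal v X) {i : Fin n} {B C : Finset (Fin m)}
    (h : val v i B < val v i C) : relVal v X i B < relVal v X i C :=
  div_lt_div_of_pos_right h (hX.pos i)

/-- If every agent `i` passes the part `R i` of `X i` on to agent `σ i`, the product of the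
relative values does not exceed `1`. -/
theorem IsPosOptimal.prod_exchange_le (hX : IsPosOptimal v X) (σ : Equiv.Perm (Fin n))
    {R : Fin n → Finset (Fin m)} (hR : ∀ i, R i ⊆ X i) :
    ∏ i, (1 - relVal v X i (R i) + relVal v X i (R (σ.symm i))) ≤ 1 := by
  have hdisj : ∀ i, Disjoint (X i \ R i) (R (σ.symm i)) := by
    intro i
    by_cases h : σ.symm i = i
    · rw [h]; exact Finset.sdiff_disjoint
    · exact ((hX.alloc.1 _ _ (Ne.symm h)).mono_left Finset.sdiff_subset).mono_right (hR _)
  have hle := hX.le (fun i => (X i \ R i) ∪ R (σ.symm i)) ⟨fun i j hij => ?_, ?_⟩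
  · rw [← div_le_one (Finset.prod_pos fun i _ => hX.pos i), ← Finset.prod_div_distrib] at hle
    refine le_of_eq_of_le (Finset.prod_congr rfl fun i _ => ?_) hle
    rw [val_union i (hdisj i), val_sdiff i (hR i), add_div, sub_div, div_self (hX.pos i).ne']
    rfl
  · -- The released parts are disjoint from all kept parts, their own included.
    have hXR : ∀ k l, Disjoint (X k \ R k) (R l) := by
      intro k l
      by_cases h : k = l
      · rw [h]; exact Finset.sdiff_disjoint
      · exact ((hX.alloc.1 _ _ h).mono_left Finset.sdiff_subset).mono_right (hR _)
    refine Finset.disjoint_union_left.2 ⟨Finset.disjoint_union_right.2 ⟨?_, hXR _ _⟩,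
      Finset.disjoint_union_right.2 ⟨(hXR _ _).symm, ?_⟩⟩
    · exact ((hX.alloc.1 _ _ hij).mono_left Finset.sdiff_subset).mono_right Finset.sdiff_subset
    · exact ((hX.alloc.1 _ _ fun h => hij (σ.symm.injective h)).mono_left (hR _)).mono_right (hR _)
  · refine Finset.eq_univ_iff_forall.2 fun g => ?_
    have hg : g ∈ Finset.univ.biUnion X := by rw [hX.alloc.2]; simp
    obtain ⟨i, -, hi⟩ := Finset.mem_biUnion.1 hg
    by_cases h : g ∈ R i
    · exact Finset.mem_biUnion.2 ⟨σ i, by simp, by simp [h]⟩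
    · exact Finset.mem_biUnion.2 ⟨i, by simp, by simp [h, hi]⟩

/-- The version of `prod_exchange_le` for a path `a 0, …, a k` of distinct agents: `a l` passes
`R l` on to `a (l + 1)`, and `a k` passes on nothing. -/
theorem IsPosOptimal.prod_path_le (hv : ∀ i g, 0 < v i g) (hX : IsPosOptimal v X)
    {a : ℕ → Fin n} {k : ℕ} (ha : Set.InjOn a (Set.Iic k)) (σ : Equiv.Perm (Fin n))
    (hσ : ∀ l < k, σ (a l) = a (l + 1)) {R : ℕ → Finset (Fin m)} (hR : ∀ l < k, R l ⊆ X (a l))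
    (hRk : R k = ∅) :
    (1 - relVal v X (a 0) (R 0)) *
      ∏ l ∈ Finset.range k,
        (1 - relVal v X (a (l + 1)) (R (l + 1)) + relVal v X (a (l + 1)) (R l)) ≤ 1 := by
  classical
  have hR' : ∀ l ≤ k, R l ⊆ X (a l) := fun l hl => by
    rcases hl.lt_or_eq with h | rfl
    · exact hR l h
    · rw [hRk]; exact Finset.empty_subset _
  let S : Fin n → Finset (Fin m) := fun i =>
    (Finset.range (k + 1)).biUnion fun l => if a l = i then R l else ∅
  have hS : ∀ l ≤ k, S (a l) = R l := by
    intro l hl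
    ext g
    simp only [S, Finset.mem_biUnion, Finset.mem_range]
    constructor
    · rintro ⟨r, hr, hg⟩
      split_ifs at hg with h
      · rwa [← ha (Nat.lt_succ_iff.1 hr) hl h]
      · simp at hg
    · intro hg
      exact ⟨l, by omega, by simpa using hg⟩
  have hSX : ∀ i, S i ⊆ X i := by
    intro i
    refine Finset.biUnion_subset.2 fun l hl => ?_
    split_ifs with h
    · rw [← h]; exact hR' l (Nat.lt_succ_iff.1 (Finset.mem_range.1 hl))
    · exact Finset.empty_subset _
  have hS0 : ∀ i, i ∉ (Finset.range (k + 1)).image a → S i = ∅ := by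
    intro i hi
    refine Finset.eq_empty_of_forall_notMem fun g hg => ?_
    obtain ⟨l, hl, hg⟩ := Finset.mem_biUnion.1 hg
    split_ifs at hg with h
    · exact hi (Finset.mem_image.2 ⟨l, hl, h⟩)
    · simp at hg
  set G : Fin n → ℝ := fun i => 1 - relVal v X i (S i) + relVal v X i (S (σ.symm i)) with hG
  have hle : ∏ i ∈ (Finset.range (k + 1)).image a, G i ≤ ∏ i, G i := by
    rw [← Finset.univ_inter ((Finset.range (k + 1)).image a), ← Finset.prod_ite_mem]
    refine Finset.prod_le_prod (fun i _ => ?_) fun i _ => ?_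
    · split_ifs
      · have := relVal_le_one hv hX (hSX i)
        have := relVal_nonneg hv hX i (S (σ.symm i))
        simp only [hG]; linarith
      · exact zero_le_one
    · split_ifs with h
      · exact le_rfl
      · have := relVal_nonneg hv hX i (S (σ.symm i))
        simp only [hG, hS0 i h, relVal_empty]
        linarith
  refine le_trans ?_ (hle.trans (hX.prod_exchange_le σ hSX))
  rw [Finset.prod_image fun l hl r hr h => ha (Nat.lt_succ_iff.1 (by simpa using hl))
    (Nat.lt_succ_iff.1 (by simpa using hr)) h, Finset.prod_range_succ', mul_comm]
  have h1 : ∏ l ∈ Finset.range k,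
        (1 - relVal v X (a (l + 1)) (R (l + 1)) + relVal v X (a (l + 1)) (R l)) =
      ∏ l ∈ Finset.range k, G (a (l + 1)) := by
    refine Finset.prod_congr rfl fun l hl => ?_
    have hl' := Finset.mem_range.1 hl
    have : σ.symm (a (l + 1)) = a l := by rw [← hσ l hl', Equiv.symm_apply_apply]
    simp only [hG]
    rw [this, hS _ hl', hS _ hl'.le]
  rw [h1]
  refine mul_le_mul_of_nonneg_left ?_ (Finset.prod_nonneg fun l hl => ?_)
  · have := relVal_nonneg hv hX (a 0) (S (σ.symm (a 0)))
    simp only [hG]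
    rw [hS 0 (Nat.zero_le _)]
    linarith
  · have := relVal_le_one hv hX (hSX (a (l + 1)))
    have := relVal_nonneg hv hX (a (l + 1)) (S (σ.symm (a (l + 1))))
    simp only [hG]; linarith

/-- First-order optimality of `X`: in a large market, the relative value of a part of `X j` for
another agent is at most `1 / (1 - ε)` times its relative value for `j`. -/
theorem relVal_le_of_ne (hv : ∀ i g, 0 < v i g) (hX : IsPosOptimal v X) {ε : ℝ} (hε : ε < 1)
    (hlarge : LargeMarket v X ε) {i j : Fin n} (hij : i ≠ j) {B : Finset (Fin m)} (hB : B ⊆ X j) :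
    relVal v X i B ≤ relVal v X j B / (1 - ε) := by
  have h1ε : 0 < 1 - ε := by linarith
  have key : ∀ g ∈ B, v i g / val v i (X i) ≤ v j g / val v j (X j) / (1 - ε) := by
    intro g hg
    have h := hX.prod_path_le hv (a := fun l => if l = 0 then j else i) (k := 1)
      (R := fun l => if l = 0 then {g} else ∅)
      (fun l hl r hr h => by
        have hl' : l ≤ 1 := hl
        have hr' : r ≤ 1 := hr
        interval_cases l <;> interval_cases r <;> simp_all [eq_comm])
      (Equiv.swap i j) (fun l hl => by
        have : l = 0 := by omega
        simp [this])
      (fun l hl => by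
        have : l = 0 := by omega
        simpa [this] using hB hg) (by simp)
    have hval : ∀ k, relVal v X k {g} = v k g / val v k (X k) := fun k => by simp [relVal, val]
    simp only [Finset.prod_range_one, if_true, one_ne_zero, zero_add, if_false, relVal_empty,
      sub_zero, hval] at h
    have hp : v j g / val v j (X j) ≤ ε :=
      (div_le_iff₀ (hX.pos j)).2 (hlarge j g (hB hg))
    have hp0 : 0 ≤ v j g / val v j (X j) := div_nonneg (hv j g).le (hX.pos j).le
    have hu0 : 0 ≤ v i g / val v i (X i) := div_nonneg (hv i g).le (hX.pos i).le
    rw [le_div_iff₀ h1ε]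
    nlinarith [mul_nonneg hu0 (sub_nonneg.2 hp)]
  simp only [relVal, val, Finset.sum_div]
  exact Finset.sum_le_sum key

/-- Subsets of a bundle attain every value up to an error of one item. -/
theorem exists_subset_relVal (hX : IsPosOptimal v X) {ε τ : ℝ}
    (hlarge : LargeMarket v X ε) (hε : 0 ≤ ε) {i : Fin n} {B : Finset (Fin m)} (hB : B ⊆ X i)
    (hτ : 0 ≤ τ) (hτB : τ ≤ relVal v X i B) :
    ∃ T ⊆ B, relVal v X i T ≤ τ ∧ τ - ε ≤ relVal v X i T := by
  classical
  obtain ⟨T, hT, hmax⟩ := (B.powerset.filter fun T => relVal v X i T ≤ τ).exists_max_image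
    Finset.card ⟨∅, by simpa [relVal_empty] using hτ⟩
  simp only [Finset.mem_filter, Finset.mem_powerset] at hT hmax
  refine ⟨T, hT.1, hT.2, ?_⟩
  by_cases hTB : T = B
  · rw [hTB]; linarith
  obtain ⟨g, hgB, hgT⟩ := Finset.exists_of_ssubset (hT.1.ssubset_of_ne hTB)
  by_contra! hlt
  have hg : v i g / val v i (X i) ≤ ε := (div_le_iff₀ (hX.pos i)).2 (hlarge i g (hB hgB))
  have hins : relVal v X i (insert g T) = v i g / val v i (X i) + relVal v X i T := by
    simp only [relVal, val, Finset.sum_insert hgT, add_div]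
  have := hmax (insert g T) ⟨Finset.insert_subset hgB hT.1, by linarith⟩
  rw [Finset.card_insert_of_notMem hgT] at this
  omega

/-- A path along which each agent prefers the bundle of her predecessor to her own bundle, and
which ends with an agent whose bundle has lost nothing. -/
structure IsEnvyPath (v : Fin n → Fin m → ℝ) (X Z : Fin n → Finset (Fin m)) (a : ℕ → Fin n)
    (k : ℕ) : Prop where
  injOn : Set.InjOn a (Set.Iic k)
  exists_perm : ∃ σ : Equiv.Perm (Fin n), ∀ l < k, σ (a l) = a (l + 1)
  envy : ∀ l < k, val v (a (l + 1)) (Z (a (l + 1))) < val v (a (l + 1)) (Z (a l))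
  last : Z (a k) = X (a k)

variable {Z : Fin n → Finset (Fin m)} {a : ℕ → Fin n} {k : ℕ}

/-- Shifting all bundles along the path doubles the value of the last agent, who keeps her own
bundle, and improves all others but the first. So the first bundle is worth at least one half. -/
theorem IsEnvyPath.half_le (hv : ∀ i g, 0 < v i g) (hX : IsPosOptimal v X) (hZ : ∀ i, Z i ⊆ X i)
    (h : IsEnvyPath v X Z a k) : 1 / 2 ≤ relVal v X (a 0) (Z (a 0)) := by
  obtain ⟨σ, hσ⟩ := h.exists_perm
  cases k with
  | zero => rw [h.last, relVal_self hX]; norm_num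
  | succ k =>
    have hle := hX.prod_path_le hv h.injOn σ hσ (R := fun l => if l < k + 1 then Z (a l) else ∅)
      (fun l hl => by simpa [hl] using hZ _) (by simp)
    rw [Finset.prod_range_succ] at hle
    simp only [Nat.succ_pos, if_true, lt_irrefl, if_false, relVal_empty, lt_add_one] at hle
    have h1 : 1 ≤ ∏ l ∈ Finset.range k, (1 - relVal v X (a (l + 1))
        (if l + 1 < k + 1 then Z (a (l + 1)) else ∅) +
        relVal v X (a (l + 1)) (if l < k + 1 then Z (a l) else ∅)) := by
      refine Finset.prod_const_one.symm.le.trans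
        (Finset.prod_le_prod (fun _ _ => zero_le_one) fun l hl => ?_)
      have hl' := Finset.mem_range.1 hl
      rw [if_pos (by omega), if_pos (by omega)]
      have := relVal_lt hX (h.envy l (by omega))
      linarith
    have h2 := relVal_lt hX (h.envy k (by omega))
    rw [h.last, relVal_self hX] at h2
    have h3 := relVal_le_one hv hX (hZ (a 0))
    have h4 : 2 ≤ (∏ l ∈ Finset.range k, (1 - relVal v X (a (l + 1))
        (if l + 1 < k + 1 then Z (a (l + 1)) else ∅) +
        relVal v X (a (l + 1)) (if l < k + 1 then Z (a l) else ∅))) *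
        (1 - 0 + relVal v X (a (k + 1)) (Z (a k))) := by nlinarith
    have h5 := mul_le_mul_of_nonneg_left h4 (sub_nonneg.2 h3)
    linarith

/-- Going back along the path, the relative value of a bundle for its own agent falls to no less
than `1 - ε` times its value in each step. -/
theorem IsEnvyPath.pow_le (hv : ∀ i g, 0 < v i g) (hX : IsPosOptimal v X) (hZ : ∀ i, Z i ⊆ X i)
    {ε : ℝ} (hε1 : ε < 1) (hlarge : LargeMarket v X ε) (h : IsEnvyPath v X Z a k) {r : ℕ}
    (hr : r ≤ k) : (1 - ε) ^ r ≤ relVal v X (a (k - r)) (Z (a (k - r))) := by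
  induction r with
  | zero => rw [pow_zero, Nat.sub_zero, h.last, relVal_self hX]
  | succ r ih =>
    have ih := ih (by omega)
    have hk : k - r = k - (r + 1) + 1 := by omega
    rw [hk] at ih
    have h1 := relVal_lt hX (h.envy (k - (r + 1)) (by omega))
    have hne : a (k - (r + 1) + 1) ≠ a (k - (r + 1)) := fun he => by
      have := h.injOn (show k - (r + 1) + 1 ≤ k by omega) (show k - (r + 1) ≤ k by omega) he
      omega
    have h2 := relVal_le_of_ne hv hX hε1 hlarge hne (hZ (a (k - (r + 1))))
    have h3 := (ih.trans h1.le).trans h2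
    rw [le_div_iff₀ (by linarith)] at h3
    rwa [pow_succ]

/-- If the first bundle were worth less than `1 - 4 * √ε`, and no other bundle less than the first,
the path would be long enough to pass goods along it according to `rampTarget`, with a gain in Nash
welfare. -/
theorem IsEnvyPath.one_sub_le (hv : ∀ i g, 0 < v i g) (hX : IsPosOptimal v X)
    (hZ : ∀ i, Z i ⊆ X i) {ε : ℝ} (hε : 0 < ε) (hs8 : √ε < 1 / 8) (hlarge : LargeMarket v X ε)
    (h : IsEnvyPath v X Z a k)
    (hmin : ∀ l ≤ k, relVal v X (a 0) (Z (a 0)) ≤ relVal v X (a l) (Z (a l))) :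
    1 - 4 * √ε ≤ relVal v X (a 0) (Z (a 0)) := by
  by_contra! hlt
  obtain ⟨σ, hσ⟩ := h.exists_perm
  set s := √ε with hs_def
  have hs : 0 < s := Real.sqrt_pos.2 hε
  have hεs : ε = s ^ 2 := (Real.sq_sqrt hε.le).symm
  have hε1 : ε < 1 / 64 := by rw [hεs]; nlinarith
  set p := relVal v X (a 0) (Z (a 0)) with hp_def
  have hp0 : 0 ≤ p := relVal_nonneg hv hX _ _
  have hbern : ∀ r ≤ k, 1 - r * ε ≤ relVal v X (a (k - r)) (Z (a (k - r))) := fun r hr =>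
    le_trans (by have := one_add_mul_le_pow (show -2 ≤ -ε by linarith) r
                 rw [← sub_eq_add_neg] at this; linarith)
      (h.pow_le hv hX hZ (by linarith) hlarge hr)
  have hk : 4 < k * s := by
    have h1 := hbern k le_rfl
    rw [Nat.sub_self] at h1
    have h2 : 4 * s < k * s * s := by rw [hεs] at h1; nlinarith
    exact lt_of_mul_lt_mul_right h2 hs.le
  obtain ⟨N, hN⟩ : ∃ N, N = ⌈1 / s⌉₊ := ⟨_, rfl⟩
  have hN1 : 1 / s ≤ N := hN ▸ Nat.le_ceil _
  have hN2 : (N : ℝ) < 1 / s + 1 := hN ▸ Nat.ceil_lt_add_one (by positivity)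
  have hNpos : (0 : ℝ) < N := lt_of_lt_of_le (by positivity) hN1
  have hN0 : 0 < N := by exact_mod_cast hNpos
  have hNε : N * ε ≤ 1 := by
    have h1 : N * s < (1 / s + 1) * s := mul_lt_mul_of_pos_right hN2 hs
    have h3 : (1 / s + 1) * s = 1 + s := by field_simp
    rw [hεs]; nlinarith
  obtain ⟨q, rfl⟩ : ∃ q, k = N + q + N := by
    have : N + N ≤ k := by
      have h1 : ((N + N : ℕ) : ℝ) * s ≤ k * s := by
        have h1 : N * s < (1 / s + 1) * s := mul_lt_mul_of_pos_right hN2 hs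
        have h3 : (1 / s + 1) * s = 1 + s := by field_simp
        push_cast; linarith
      exact_mod_cast le_of_mul_le_mul_right h1 hs
    exact ⟨k - (N + N), by omega⟩
  have hτ : ∀ l ≤ N + q + N, rampTarget p N q l ≤ relVal v X (a l) (Z (a l)) := by
    intro l hl
    rcases lt_or_ge l N with h1 | h1
    · rw [rampTarget_of_lt h1]
      refine le_trans ?_ (hmin l hl)
      have : 0 ≤ ((l : ℝ) + 1) / N := by positivity
      nlinarith
    rcases le_or_gt l (N + q) with h2 | h2
    · rw [rampTarget_eq_zero (by omega) h2 hN0]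
      exact relVal_nonneg hv hX _ _
    · obtain ⟨r, rfl⟩ := Nat.exists_eq_add_of_le h2.le
      obtain ⟨r', rfl⟩ := Nat.exists_eq_add_of_le (show r ≤ N by omega)
      have h3 := hbern r' (by omega)
      rw [show r + r' + q + (r + r') - r' = r + r' + q + r by omega] at h3
      refine le_trans ?_ h3
      rw [rampTarget_add, div_le_iff₀ hNpos]
      push_cast at hNε ⊢
      have : (0 : ℝ) ≤ r' := Nat.cast_nonneg _
      nlinarith
  have hT : ∀ l, ∃ T, l ≤ N + q + N → T ⊆ Z (a l) ∧ relVal v X (a l) T ≤ rampTarget p N q l ∧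
      rampTarget p N q l - ε ≤ relVal v X (a l) T ∧ (l = N + q + N → T = Z (a l)) := by
    intro l
    by_cases hl : l ≤ N + q + N
    · by_cases hlk : l = N + q + N
      · refine ⟨Z (a l), fun _ => ⟨subset_rfl, ?_, by linarith [hτ l hl], fun _ => rfl⟩⟩
        rw [hlk, rampTarget_add, div_self hNpos.ne', h.last, relVal_self hX]
      · obtain ⟨T, h1, h2, h3⟩ := exists_subset_relVal hX hlarge hε.le (hZ (a l))
          (rampTarget_nonneg hp0 hN0 l) (hτ l hl)
        exact ⟨T, fun _ => ⟨h1, h2, h3, fun h => absurd h hlk⟩⟩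
    · exact ⟨∅, fun h => absurd h hl⟩
  choose T hT using hT
  have hTk := (hT _ le_rfl).2.2.2 rfl
  have hle := hX.prod_path_le hv h.injOn σ hσ (R := fun l => Z (a l) \ T l)
    (fun l _ => Finset.sdiff_subset.trans (hZ _)) (by simp [hTk])
  obtain ⟨hpos, hgt⟩ := one_lt_prod_ramp (q := q) (t := fun l => relVal v X (a l) (T l)) hs hs8 hεs
    hp0 hlt hN1 hN2 (fun l _ => relVal_nonneg hv hX _ _) (fun l hl => (hT l hl).2.1)
    (fun l hl => (hT l hl).2.2.1) (by rw [hTk, h.last, relVal_self hX])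
  refine absurd (lt_of_lt_of_le hgt ?_) (not_lt.2 hle)
  rw [relVal_sdiff _ (hT 0 (Nat.zero_le _)).1, ← hp_def, sub_sub_eq_add_sub, add_sub_right_comm]
  refine mul_le_mul_of_nonneg_left (Finset.prod_le_prod (fun l hl => ?_) fun l hl => ?_) ?_
  · exact (hpos l (Finset.mem_range.1 hl)).le
  · have hl' := Finset.mem_range.1 hl
    have hne : a (l + 1) ≠ a l := fun he => by
      have := h.injOn (show l + 1 ≤ _ by exact hl') (show l ≤ _ by exact hl'.le) he
      omega
    have h1 := relVal_le_of_ne hv hX (by linarith) hlarge hne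
      ((hT l hl'.le).1.trans (hZ _))
    have h2 := relVal_lt hX (h.envy l hl')
    rw [relVal_sdiff _ (hT (l + 1) hl').1, relVal_sdiff _ (hT l hl'.le).1]
    linarith
  · have := relVal_nonneg hv hX (a 0) (T 0)
    have : p ≤ 1 := by linarith
    linarith

end

/-! ### Bundles retain most of their value -/

section

variable {n m : ℕ} {v : Fin n → Fin m → ℝ} {X Z : Fin n → Finset (Fin m)}

/-- If a touched bundle `Z j` is matched to an agent other than `j`, an envy path starts at `j`:
pass from an agent to the one who is matched to her bundle, until that bundle is untouched. If this
never happened, the agents would form a cycle, and shifting the bundles along it would improve all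
of them. -/
theorem exists_isEnvyPath (hX : IsPosOptimal v X) (hZ : ∀ i, Z i ⊆ X i)
    {M : Finset (Fin n × Fin n)} (hM : CoversTouched v X Z M) {i j : Fin n} (hij : i ≠ j)
    (hmem : (i, j) ∈ M) (hj : Z j ≠ X j) : ∃ a k, a 0 = j ∧ IsEnvyPath v X Z a k := by
  classical
  have hf : ∀ l, ∃ r, Z l ≠ X l → (r, l) ∈ M := fun l => by
    by_cases h : Z l = X l
    · exact ⟨l, fun h' => absurd h h'⟩
    · obtain ⟨r, hr⟩ := hM.2 l h
      exact ⟨r, fun _ => hr⟩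
  choose f hf using hf
  obtain ⟨g, hg⟩ := Finset.exists_equiv_extend_of_card_eq (t := (Finset.univ : Finset (Fin n)))
    (by simp) (s := Finset.univ.filter fun l => Z l ≠ X l) (f := f) (Finset.subset_univ _)
    fun l hl r hr h => congrArg Prod.snd
      (hM.1.2 _ (hf l (by simpa using hl)) _ (hf r (by simpa using hr)) (Or.inl h))
  let σ : Equiv.Perm (Fin n) := g.trans (Equiv.subtypeUnivEquiv fun x => Finset.mem_univ x)
  have hσ : ∀ l, Z l ≠ X l → (σ l, l) ∈ M := fun l hl => by
    have : σ l = f l := hg l (by simpa using hl)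
    rw [this]; exact hf l hl
  have hσj : σ j = i := congrArg Prod.fst (hM.1.2 _ (hσ j hj) _ hmem (Or.inr rfl))
  have hne : ∀ r : ℕ, (σ ^ (r + 1)) j ≠ (σ ^ r) j := fun r h => by
    rw [pow_succ, Equiv.Perm.mul_apply, hσj] at h
    exact hij ((σ ^ r).injective h)
  have henvy : ∀ r : ℕ, Z ((σ ^ r) j) ≠ X ((σ ^ r) j) →
      val v ((σ ^ (r + 1)) j) (Z ((σ ^ (r + 1)) j)) < val v ((σ ^ (r + 1)) j) (Z ((σ ^ r) j)) := by
    intro r hr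
    have h := hM.1.1 _ (hσ _ hr)
    rw [← Equiv.Perm.mul_apply, ← pow_succ'] at h
    exact h.2 (hne r)
  have hend : ∃ k : ℕ, Z ((σ ^ k) j) = X ((σ ^ k) j) := by
    by_contra! hall
    have hgain : ∀ l, σ.SameCycle j l →
        1 < 1 - relVal v X l (Z l) + relVal v X l (Z (σ.symm l)) := by
      intro l hl
      obtain ⟨r, hr, -, rfl⟩ := hl.exists_pow_eq''
      obtain ⟨r, rfl⟩ : ∃ s, r = s + 1 := ⟨r - 1, by omega⟩
      have := relVal_lt hX (henvy r (hall r))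
      have h2 : σ.symm ((σ ^ (r + 1)) j) = (σ ^ r) j := by
        rw [pow_succ', Equiv.Perm.mul_apply, Equiv.symm_apply_apply]
      rw [h2]
      linarith
    have hle := hX.prod_exchange_le σ (R := fun l => if σ.SameCycle j l then Z l else ∅) fun l => by
      split_ifs
      · exact hZ l
      · exact Finset.empty_subset _
    have hiff : ∀ l, σ.SameCycle j (σ.symm l) ↔ σ.SameCycle j l := fun l =>
      Equiv.Perm.sameCycle_symm_apply_right
    have hcycle : ∀ l, σ.SameCycle j l → 1 < 1 - relVal v X l (if σ.SameCycle j l then Z l else ∅) +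
        relVal v X l (if σ.SameCycle j (σ.symm l) then Z (σ.symm l) else ∅) := fun l hl => by
      rw [if_pos hl, if_pos ((hiff l).2 hl)]
      exact hgain l hl
    refine absurd hle (not_le.2 ?_)
    refine Finset.prod_const_one.symm.trans_lt (Finset.prod_lt_prod (fun _ _ => zero_lt_one)
      (fun l _ => ?_) ⟨j, Finset.mem_univ _, hcycle j (Equiv.Perm.SameCycle.refl _ _)⟩)
    by_cases hl : σ.SameCycle j l
    · exact (hcycle l hl).le
    · rw [if_neg hl, if_neg fun h => hl ((hiff l).1 h), relVal_empty]
      linarith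
  have hmin := fun r => Nat.find_min hend (m := r)
  refine ⟨fun r => (σ ^ r) j, Nat.find hend, rfl, ?_, ⟨σ, fun l _ => ?_⟩,
    fun l hl => henvy l (hmin l hl), Nat.find_spec hend⟩
  · -- A repetition before the end would make the path periodic, and the end would come earlier.
    have hlt : ∀ r s, r < s → s ≤ Nat.find hend → (σ ^ r) j ≠ (σ ^ s) j := by
      intro r s hrs hs h
      refine hmin (Nat.find hend - s + r) (by omega) ?_
      have h2 : (σ ^ (Nat.find hend - s + r)) j = (σ ^ Nat.find hend) j := by
        conv_rhs => rw [← Nat.sub_add_cancel hs]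
        rw [pow_add, pow_add, Equiv.Perm.mul_apply, Equiv.Perm.mul_apply, h]
      rw [h2]
      exact Nat.find_spec hend
    intro r hr s hs h
    by_contra hrs
    rcases Nat.lt_or_gt_of_ne hrs with h' | h'
    · exact hlt r s h' hs h
    · exact hlt s r h' hr h.symm
  · rw [pow_succ', Equiv.Perm.mul_apply]

/-- Throughout a run every bundle retains half of its original value for its own agent, and the
share `1 - 4 * √ε` if `√ε < 1 / 8`. -/
theorem Reaches.relVal_ge (hv : ∀ i g, 0 < v i g) (hX : IsPosOptimal v X) {ε : ℝ} (hε : 0 < ε)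
    (hlarge : LargeMarket v X ε) {t : ℕ} (h : Reaches v X t Z) (i : Fin n) :
    1 / 2 ≤ relVal v X i (Z i) ∧ (√ε < 1 / 8 → 1 - 4 * √ε ≤ relVal v X i (Z i)) := by
  induction h generalizing i with
  | start =>
    rw [relVal_self hX]
    exact ⟨by norm_num, fun _ => by linarith [Real.sqrt_nonneg ε]⟩
  | round t Z Z' hreach hstep ih =>
    have hZ' := ((Reaches.round t Z Z' hreach hstep).invariant hv).1
    have hZX := (hreach.invariant hv).1
    obtain ⟨M, k, j, c, hc, hkj, hZ, hM, hmem⟩ := hstep.exists_coversTouched hv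
    have hother : ∀ l, l ≠ j → Z' l = Z l := fun l hl => by rw [hZ, Function.update_of_ne hl]
    by_cases hij : i = j
    · have htouched : Z' i ≠ X i := fun he => by
        have h1 : c ∈ Z' i := he ▸ hZX i (hij ▸ hc)
        rw [hZ, hij, Function.update_self] at h1
        simp at h1
      subst hij
      obtain ⟨a, k, rfl, hpath⟩ := exists_isEnvyPath hX hZ' hM hkj hmem htouched
      refine ⟨hpath.half_le hv hX hZ', fun hs => ?_⟩
      by_contra! hlt
      refine absurd (hpath.one_sub_le hv hX hZ' hε hs hlarge fun l _ => ?_) (not_le.2 hlt)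
      by_cases hl : a l = a 0
      · rw [hl]
      · rw [hother _ hl]
        exact hlt.le.trans ((ih (a l)).2 hs)
    · rw [hother i hij]
      exact ih i

theorem Reaches.val_le (hv : ∀ i g, 0 < v i g) (hX : IsPosOptimal v X) {ε : ℝ} (hε : 0 < ε)
    (hlarge : LargeMarket v X ε) {t : ℕ} (h : Reaches v X t Z) (i : Fin n) :
    val v i (X i) ≤ (1 + 8 * √ε) * val v i (Z i) := by
  have hs := Real.sqrt_nonneg ε
  have h1 : 1 ≤ (1 + 8 * √ε) * relVal v X i (Z i) := by
    obtain ⟨h2, h3⟩ := h.relVal_ge hv hX hε hlarge i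
    rcases lt_or_ge (√ε) (1 / 8) with hlt | hge
    · have := h3 hlt
      nlinarith
    · nlinarith
  rw [relVal, ← mul_div_assoc, le_div_iff₀ (hX.pos i), one_mul] at h1
  exact h1

/-! ### Nash welfare -/

theorem nashWelfare_nonneg (hv : ∀ i g, 0 < v i g) (A : Fin n → Finset (Fin m)) :
    0 ≤ nashWelfare v A :=
  Real.rpow_nonneg (Finset.prod_nonneg fun i _ => val_nonneg hv i _) _

theorem nashWelfare_le_mul (hv : ∀ i g, 0 < v i g) {α : ℝ} (hα : 1 ≤ α)
    {A B : Fin n → Finset (Fin m)} (h : ∀ i, val v i (A i) ≤ α * val v i (B i)) :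
    nashWelfare v A ≤ α * nashWelfare v B := by
  rcases Nat.eq_zero_or_pos n with rfl | hn
  · simpa [nashWelfare] using hα
  have hα0 : 0 ≤ α := by linarith
  have hB : 0 ≤ ∏ i, val v i (B i) := Finset.prod_nonneg fun i _ => val_nonneg hv i _
  have h1 : ∏ i, val v i (A i) ≤ α ^ n * ∏ i, val v i (B i) :=
    (Finset.prod_le_prod (fun i _ => val_nonneg hv i _) fun i _ => h i).trans_eq (by
      rw [Finset.prod_mul_distrib]; simp)
  calc nashWelfare v A ≤ (α ^ n * ∏ i, val v i (B i)) ^ ((1 : ℝ) / n) :=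
        Real.rpow_le_rpow (Finset.prod_nonneg fun i _ => val_nonneg hv i _) h1 (by positivity)
    _ = α * nashWelfare v B := by
        rw [Real.mul_rpow (by positivity) hB, one_div, Real.pow_rpow_inv_natCast hα0 hn.ne',
          nashWelfare, one_div]

theorem nashWelfare_le_opt {S : Finset (Fin m)} {A : Fin n → Finset (Fin m)}
    (hA : IsAllocation A S) : nashWelfare v A ≤ opt v S := by
  refine le_csSup (Set.Finite.bddAbove ?_) ⟨A, hA, rfl⟩
  refine (Set.finite_range (nashWelfare v)).subset ?_
  rintro w ⟨B, -, rfl⟩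
  exact ⟨B, rfl⟩

theorem isPosOptimal_of_nashWelfare_eq_opt (hv : ∀ i g, 0 < v i g)
    (hX : IsAllocation X Finset.univ) (hopt : nashWelfare v X = opt v Finset.univ)
    (hpos : ∏ i, val v i (X i) ≠ 0) : IsPosOptimal v X := by
  refine ⟨hX, fun i => (val_nonneg hv i _).lt_of_ne fun h =>
    hpos (Finset.prod_eq_zero (Finset.mem_univ i) h.symm), fun A hA => ?_⟩
  rcases Nat.eq_zero_or_pos n with rfl | hn
  · simp
  have h := nashWelfare_le_opt (v := v) hA
  rw [← hopt] at h
  exact (Real.rpow_le_rpow_iff (Finset.prod_nonneg fun i _ => val_nonneg hv i _)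
    (Finset.prod_nonneg fun i _ => val_nonneg hv i _) (by positivity)).1 h

end

end EFXDonation

theorem theorem4 {n m : ℕ} (v : Fin n → Fin m → ℝ) (hv : ∀ i g, 0 < v i g)
    (X : Fin n → Finset (Fin m)) (hX : IsAllocation X Finset.univ)
    (hopt : nashWelfare v X = opt v Finset.univ)
    (ε : ℝ) (hε : 0 < ε) (hlarge : LargeMarket v X ε) :
    NeverStuck v X ∧ (∀ t Z, Reaches v X t Z → t ≤ m) ∧ (∃ Y, Returns v X Y) ∧
      ∀ Y, Returns v X Y →
        (∃ S, IsAllocation Y S) ∧ IsEFX v Y ∧ IsEfficient v (1 + 8 * Real.sqrt ε) Y := by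
  refine ⟨fun t Z hZ => ⟨exists_isRoundMatching (hZ.invariant hv).2.2, fun M i hM hi j hj =>
    exists_isLeastItem i (nonempty_of_unmatched hv hM hi hj)⟩, fun t Z hZ => ?_,
    exists_returns hv, ?_⟩
  · have := (hZ.invariant hv).2.1
    rw [hX.sum_card] at this
    omega
  rintro Y ⟨t, Z, M, hZ, hM, hcard, hY⟩
  obtain ⟨σ, hσ⟩ := exists_perm_of_card_eq hM.1.1 hcard
  have hYσ : ∀ i, Y i = Z (σ i) := fun i => by
    obtain ⟨j, hj, hYj⟩ := hY i
    rw [hYj, (hσ i j).1 hj]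
  have hedge : ∀ i, IsEdge v Z i (σ i) := fun i => hM.1.1.1 _ ((hσ i _).2 rfl)
  have hZX := (hZ.invariant hv).1
  refine ⟨⟨_, fun i j hij => ?_, rfl⟩, fun i j => ?_, ?_⟩
  · rw [hYσ, hYσ]
    exact ((hX.1 _ _ fun h => hij (σ.injective h)).mono_left (hZX _)).mono_right (hZX _)
  · rw [hYσ, hYσ]
    exact (hedge i).1 _
  · have hs := Real.sqrt_nonneg ε
    unfold IsEfficient
    rw [← hopt]
    by_cases hpos : ∏ i, val v i (X i) = 0
    · have hn : n ≠ 0 := by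
        rintro rfl
        simp at hpos
      have h0 : nashWelfare v X = 0 := by
        rw [nashWelfare, hpos, Real.zero_rpow (by positivity)]
      rw [h0]
      exact mul_nonneg (by linarith) (nashWelfare_nonneg hv Y)
    · have hXopt := isPosOptimal_of_nashWelfare_eq_opt hv hX hopt hpos
      refine nashWelfare_le_mul hv (by linarith) fun i => (hZ.val_le hv hXopt hε hlarge i).trans
        (mul_le_mul_of_nonneg_left ?_ (by linarith))
      rw [hYσ]
      by_cases hi : i = σ i
      · rw [← hi]
      · exact ((hedge i).2 hi).le
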